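/- A (finite) hypergraph $H=(V,E)$ has a finite vertex set $V$ and a set $E$ of nonempty subsets of $V$, its hyperedges. A labeling $f$ of $V$ by positive integers is sum-distinguishing if $\sum_{v\in e}f(v)\neq\sum_{v\in e'}f(v)$ for any two distinct hyperedges $e,e'\in E$. Let $s(H)$ be the smallest integer $N$ such that $H$ has a sum-distinguishing labeling with each label at most $N$, and let $s(n,m)$ be the largest value of $s(H)$ over all hypergraphs $H$ with $n$ vertices and $m$ hyperedges. For every $C>0$ and $\varepsilon>0$ there is $n_0$ such that for all $n>n_0$ and all integers $m$ with $n\le m\le n^{1/\varepsilon}$, $$m^{2-\varepsilon}\le s(n,m)\le \frac{m^2}{C}.$$ Consequently, for $n\le m\le n^{O(1)}$, $s(n,m)=m^2/w$, where $w=w(n,m)$ goes to infinity and is smaller than any polynomial in $m$. That is, there is a function $w$ such that for all real $a$, $C$ and all $\delta>0$ there is $n_0$ such that for all $n>n_0$ and all integers $m$ with $n\le m\le n^{a}$ we have $s(n,m)=m^2/w(n,m)$ and $C\le w(n,m)\le m^{\delta}$. -/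

import Mathlib

namespace Hypergraph

/-- The sum of the labels of the vertices of the (finite) hyperedge `e`. -/
noncomputable def labelSum {α : Type*} (f : α → ℕ) (e : Set α) : ℕ :=
  ∑ᶠ v ∈ e, f v

/-- `f` labels the vertices of `H` by positive integers, and distinct hyperedges of `H` have
distinct label sums. -/
def IsSumDistinguishing {α : Type*} (H : Hypergraph α) (f : α → ℕ) : Prop :=
  (∀ v ∈ H.vertexSet, 1 ≤ f v) ∧
    ∀ e ∈ H.edgeSet, ∀ e' ∈ H.edgeSet, e ≠ e' → labelSum f e ≠ labelSum f e'

/-- The sum-distinguishing number `s(H)`: the smallest `N` such that `H` has a sum-distinguishing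
labeling with each label at most `N`. -/
noncomputable def sumDistNumber {α : Type*} (H : Hypergraph α) : ℕ :=
  sInf {N : ℕ | ∃ f : α → ℕ, H.IsSumDistinguishing f ∧ ∀ v ∈ H.vertexSet, f v ≤ N}

/-- The values `s(H)` over all hypergraphs `H` with `n` vertices (without loss of generality the
elements of `Fin n`) and `m` hyperedges; hyperedges are nonempty and not repeated. -/
def sumDistValues (n m : ℕ) : Set ℕ :=
  {k : ℕ | ∃ H : Hypergraph (Fin n), H.vertexSet = Set.univ ∧ ∅ ∉ H.edgeSet ∧
    H.edgeSet.ncard = m ∧ H.sumDistNumber = k}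

/-- `s(n, m)`: the largest value of `s(H)` over all hypergraphs with `n` vertices and `m`
hyperedges. -/
noncomputable def maxSumDistNumber (n m : ℕ) : ℕ :=
  sSup (sumDistValues n m)

/-- `s(H)` is well defined (as a minimum): labeling by distinct powers of two works. -/
theorem isLeast_sumDistNumber {n : ℕ} (H : Hypergraph (Fin n)) :
    IsLeast {N : ℕ | ∃ f : Fin n → ℕ, H.IsSumDistinguishing f ∧ ∀ v ∈ H.vertexSet, f v ≤ N}
      H.sumDistNumber := by
  classical
  have hne : {N : ℕ | ∃ f : Fin n → ℕ, H.IsSumDistinguishing f ∧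
      ∀ v ∈ H.vertexSet, f v ≤ N}.Nonempty := by
    refine ⟨2 ^ n, fun v => 2 ^ (v : ℕ), ⟨fun v _ => Nat.one_le_two_pow, ?_⟩,
      fun v _ => Nat.pow_le_pow_right (by norm_num) v.isLt.le⟩
    intro e _ e' _ hee h
    apply hee
    have key : ∀ s : Set (Fin n), labelSum (fun v : Fin n => 2 ^ (v : ℕ)) s
        = ∑ i ∈ s.toFinset.map Fin.valEmbedding, 2 ^ i := by
      intro s
      rw [labelSum, finsum_mem_eq_toFinset_sum, Finset.sum_map]
      rfl
    rw [key, key] at h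
    have h2 := congrArg (fun k : ℕ => k.bitIndices.toFinset) h
    simp only [Finset.toFinset_bitIndices_sum_two_pow] at h2
    simpa using Finset.map_injective _ h2
  exact ⟨Nat.sInf_mem hne, fun N hN => Nat.sInf_le hN⟩

/-- `s(n, m)` is well defined (as a maximum) as soon as `m ≤ 2 ^ n - 1`. -/
theorem isGreatest_maxSumDistNumber {n m : ℕ} (hm : m ≤ 2 ^ n - 1) :
    IsGreatest (sumDistValues n m) (maxSumDistNumber n m) := by
  classical
  have hfin : (sumDistValues n m).Finite := by
    have : Finite (Hypergraph (Fin n)) :=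
      Finite.of_injective (fun H : Hypergraph (Fin n) => (H.vertexSet, H.edgeSet))
        (fun H H' h => Hypergraph.ext (Prod.ext_iff.1 h).1 (Prod.ext_iff.1 h).2)
    refine (Set.finite_range (fun H : Hypergraph (Fin n) => H.sumDistNumber)).subset ?_
    rintro k ⟨H, -, -, -, rfl⟩
    exact ⟨H, rfl⟩
  have hne : (sumDistValues n m).Nonempty := by
    have hc : m ≤ ((Finset.univ : Finset (Set (Fin n))).erase ∅).card := by
      rw [Finset.card_erase_of_mem (Finset.mem_univ _), Finset.card_univ, Fintype.card_set,
        Fintype.card_fin]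
      exact hm
    obtain ⟨T, hT, hTm⟩ := Finset.exists_subset_card_eq hc
    refine ⟨_, ⟨Set.univ, (T : Set (Set (Fin n))), fun _ _ => Set.subset_univ _⟩, rfl, ?_, ?_, rfl⟩
    · intro h
      exact (Finset.mem_erase.1 (hT (Finset.mem_coe.1 h))).1 rfl
    · simpa using hTm
  exact ⟨Nat.sSup_mem hne hfin.bddAbove, fun k hk => le_csSup hfin.bddAbove hk⟩

end Hypergraph

/-!
For the upper bound, label the vertices independently and uniformly by `1, …, 2 * M`, where
`2 * M` is about `m ^ 2 / C`. The expected number of colliding pairs of edges is then `O(C)`, and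
they can be repaired one at a time by relabeling a vertex that separates the pair: such a vertex
fails only if it separates about `M` pairs whose label sums are already close. Pairs with large
symmetric difference are rarely close, because the leading bits of the labels make the difference
of the sums an anticoncentrated multiple of `M`. Pairs with bounded symmetric difference are
separated in large numbers only by a bounded set `W` of vertices, and the at most `m * 2 ^ #W` pairs
that differ only inside `W` typically do not collide at all.

For the lower bound, take `m` random `k`-subsets of a set `U` of about `m ^ (ε / 2)` vertices, with
`k` constant. For a fixed labeling with labels at most `N` the sums take at most `k * N` values, so
as in the birthday problem they are distinct with probability about `exp (-m ^ 2 / (k * N))`. For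
`N = m ^ (2 - ε)` this is too small for any of the `N ^ #U` labelings of `U` to survive.
-/

open Finset
open scoped symmDiff

section LabelDiff

variable {V : Type*} [DecidableEq V]

/-- The signed discrepancy between the label sums of the two members of a pair of vertex sets; it
is integer-valued so that no truncated subtraction occurs. -/
def labelDiff (f : V → ℕ) (p : Finset V × Finset V) : ℤ :=
  ∑ v ∈ p.1, (f v : ℤ) - ∑ v ∈ p.2, (f v : ℤ)

lemma sum_update_eq_add_ite_mul (f : V → ℕ) (v : V) (x : ℕ) (s : Finset V) :
    ∑ u ∈ s, (Function.update f v x u : ℤ) =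
      ∑ u ∈ s, (f u : ℤ) + (if v ∈ s then 1 else 0) * (x - f v) := by
  have hterm : ∀ u ∈ s, (Function.update f v x u : ℤ) =
      f u + if v = u then (x : ℤ) - f v else 0 := by
    intro u _
    obtain rfl | hu := eq_or_ne v u
    · simp
    · simp [hu, hu.symm]
  rw [sum_congr rfl hterm, sum_add_distrib, sum_ite_eq, ite_mul, one_mul, zero_mul]

lemma labelDiff_update (f : V → ℕ) (v : V) (x : ℕ) (p : Finset V × Finset V) :
    labelDiff (Function.update f v x) p = labelDiff f p +
      ((if v ∈ p.1 then 1 else 0) - if v ∈ p.2 then 1 else 0) * (x - f v) := by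
  simp only [labelDiff, sum_update_eq_add_ite_mul]
  ring

lemma labelDiff_update_of_notMem_symmDiff (f : V → ℕ) {v : V} (x : ℕ) {p : Finset V × Finset V}
    (hv : v ∉ p.1 ∆ p.2) : labelDiff (Function.update f v x) p = labelDiff f p := by
  have hiff : v ∈ p.1 ↔ v ∈ p.2 := by rw [mem_symmDiff] at hv; tauto
  simp [labelDiff_update, hiff]

lemma labelDiff_update_inj (f : V → ℕ) {v : V} {x y : ℕ} {p : Finset V × Finset V}
    (hv : v ∈ p.1 ∆ p.2) :
    labelDiff (Function.update f v x) p = labelDiff (Function.update f v y) p ↔ x = y := by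
  simp only [labelDiff_update]
  rcases mem_symmDiff.1 hv with ⟨h₁, h₂⟩ | ⟨h₂, h₁⟩ <;> simp [h₁, h₂]

lemma abs_labelDiff_le_abs_labelDiff_update_add {f : V → ℕ} {v : V} {x N : ℕ} (hf : f v ≤ N)
    (hx : x ≤ N) (p : Finset V × Finset V) :
    |labelDiff f p| ≤ |labelDiff (Function.update f v x) p| + N := by
  rw [labelDiff_update]
  split_ifs <;> grind

/-- The ordered pairs of distinct members of `E` with equal label sums. -/
def collisions (E : Finset (Finset V)) (f : V → ℕ) : Finset (Finset V × Finset V) :=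
  {p ∈ E.offDiag | labelDiff f p = 0}

-- A pair separated by `v` collides for at most one label of `v`, so fewer than `N` dangerous pairs
-- cannot spoil all `N` labels.
lemma exists_collisions_update_subset_erase {E : Finset (Finset V)} {f : V → ℕ} {v : V} {N : ℕ}
    (hf : f v ≤ N) {p₀ : Finset V × Finset V} (hv : v ∈ p₀.1 ∆ p₀.2)
    (hN : #{p ∈ E.offDiag | v ∈ p.1 ∆ p.2 ∧ |labelDiff f p| ≤ N} < N) :
    ∃ x ∈ Icc 1 N, collisions E (Function.update f v x) ⊆ (collisions E f).erase p₀ := by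
  obtain ⟨x, hx, hsafe⟩ : ∃ x ∈ Icc 1 N, ∀ p ∈ collisions E (Function.update f v x),
      v ∉ p.1 ∆ p.2 := by
    by_contra! hbad
    have hle : #(Icc 1 N) ≤ #{p ∈ E.offDiag | v ∈ p.1 ∆ p.2 ∧ |labelDiff f p| ≤ N} := by
      refine card_le_card_of_forall_subsingleton
        (fun x p => v ∈ p.1 ∆ p.2 ∧ labelDiff (Function.update f v x) p = 0) ?_ ?_
      · intro x hx
        obtain ⟨p, hp, hvp⟩ := hbad x hx
        obtain ⟨hpE, hp0⟩ := mem_filter.1 hp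
        have hclose := abs_labelDiff_le_abs_labelDiff_update_add hf (mem_Icc.1 hx).2 p
        rw [hp0, abs_zero, zero_add] at hclose
        exact ⟨p, mem_filter.2 ⟨hpE, hvp, hclose⟩, hvp, hp0⟩
      · rintro p - x ⟨-, hvp, hx0⟩ y ⟨-, -, hy0⟩
        exact (labelDiff_update_inj f hvp).1 (hx0.trans hy0.symm)
    rw [Nat.card_Icc] at hle
    omega
  refine ⟨x, hx, fun p hp => mem_erase.2 ⟨?_, ?_⟩⟩
  · rintro rfl
    exact hsafe p hp hv
  · obtain ⟨hpE, hp0⟩ := mem_filter.1 hp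
    exact mem_filter.2 ⟨hpE, labelDiff_update_of_notMem_symmDiff f x (hsafe p hp) ▸ hp0⟩

-- Each repair moves a label sum by less than `N`, so only pairs that are initially within `c * N`
-- can start to collide during `c` repairs.
lemma exists_collisions_eq_empty_of_card_collisions_le {E : Finset (Finset V)} {W : Finset V}
    {N c : ℕ} {f : V → ℕ} (hf : ∀ v, f v ∈ Icc 1 N) (hc : #(collisions E f) ≤ c)
    (hW : ∀ p ∈ collisions E f, ¬ p.1 ∆ p.2 ⊆ W)
    (hclose : ∀ v ∉ W, #{p ∈ E.offDiag | v ∈ p.1 ∆ p.2 ∧ |labelDiff f p| ≤ c * N} < N) :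
    ∃ g : V → ℕ, (∀ v, g v ∈ Icc 1 N) ∧ collisions E g = ∅ := by
  induction c generalizing f with
  | zero => exact ⟨f, hf, card_eq_zero.1 (Nat.le_zero.1 hc)⟩
  | succ c ih =>
    obtain hempty | ⟨p₀, hp₀⟩ := (collisions E f).eq_empty_or_nonempty
    · exact ⟨f, hf, hempty⟩
    obtain ⟨v, hv, hvW⟩ := not_subset.1 (hW p₀ hp₀)
    have hfv : f v ≤ N := (mem_Icc.1 (hf v)).2
    have hfew : #{p ∈ E.offDiag | v ∈ p.1 ∆ p.2 ∧ |labelDiff f p| ≤ N} < N := by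
      refine (card_le_card (monotone_filter_right _ fun p _ hp => ⟨hp.1, hp.2.trans ?_⟩)).trans_lt
        (hclose v hvW)
      push_cast
      nlinarith
    obtain ⟨x, hx, hsub⟩ := exists_collisions_update_subset_erase hfv hv hfew
    refine ih (f := Function.update f v x) (fun u => ?_) ?_ ?_ fun u hu => ?_
    · obtain rfl | hu := eq_or_ne u v
      · simpa using hx
      · simpa [hu] using hf u
    · have := card_le_card hsub
      rw [card_erase_of_mem hp₀] at this
      omega
    · exact fun p hp => hW p (mem_of_mem_erase (hsub hp))
    · refine (card_le_card (monotone_filter_right _ fun p _ hp => ⟨hp.1, ?_⟩)).trans_lt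
        (hclose u hu)
      have := abs_labelDiff_le_abs_labelDiff_update_add hfv (mem_Icc.1 hx).2 p
      push_cast
      linarith [hp.2]

lemma card_filter_symmDiff_subset_le (E : Finset (Finset V)) (W : Finset V) :
    #{p ∈ E.offDiag | p.1 ∆ p.2 ⊆ W} ≤ #E * 2 ^ #W := by
  rw [← card_powerset, ← card_product]
  refine card_le_card_of_injOn (fun p => (p.1, p.1 ∆ p.2)) (fun p hp => ?_) ?_
  · obtain ⟨hpE, hpW⟩ := mem_filter.1 hp
    exact mem_product.2 ⟨(mem_offDiag.1 hpE).1, mem_powerset.2 hpW⟩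
  · rintro ⟨e, e₁⟩ _ ⟨e', e₂⟩ _ h
    obtain ⟨rfl, h⟩ := Prod.mk.inj h
    exact Prod.ext rfl (symmDiff_right_injective e h)

end LabelDiff

lemma centralBinom_sq_mul_le (q : ℕ) : Nat.centralBinom q ^ 2 * (2 * q + 1) ≤ 16 ^ q := by
  induction q with
  | zero => simp
  | succ q ih =>
    have hrec := Nat.succ_mul_centralBinom_succ q
    refine Nat.le_of_mul_le_mul_left ?_ (show 0 < (q + 1) ^ 2 by positivity)
    calc (q + 1) ^ 2 * (Nat.centralBinom (q + 1) ^ 2 * (2 * (q + 1) + 1))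
        = ((q + 1) * Nat.centralBinom (q + 1)) ^ 2 * (2 * q + 3) := by ring
      _ = Nat.centralBinom q ^ 2 * (2 * q + 1) * (4 * ((2 * q + 1) * (2 * q + 3))) := by
          rw [hrec]; ring
      _ ≤ 16 ^ q * (4 * (4 * (q + 1) ^ 2)) := Nat.mul_le_mul ih (by nlinarith)
      _ = (q + 1) ^ 2 * 16 ^ (q + 1) := by ring

lemma mul_centralBinom_sq_le (a : ℕ) : a * Nat.centralBinom (a ^ 2) ≤ 4 ^ a ^ 2 := by
  refine (Nat.pow_le_pow_iff_left two_ne_zero).1 ?_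
  calc (a * Nat.centralBinom (a ^ 2)) ^ 2 = Nat.centralBinom (a ^ 2) ^ 2 * a ^ 2 := by ring
    _ ≤ Nat.centralBinom (a ^ 2) ^ 2 * (2 * a ^ 2 + 1) := by gcongr; omega
    _ ≤ 16 ^ a ^ 2 := centralBinom_sq_mul_le _
    _ = (4 ^ a ^ 2) ^ 2 := by rw [← pow_mul, mul_comm, pow_mul]; norm_num

lemma mul_choose_le_two_pow {a d : ℕ} (had : 2 * a ^ 2 ≤ d) (s : ℕ) :
    a * d.choose s ≤ 2 ^ d := by
  induction d, had using Nat.le_induction generalizing s with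
  | base =>
    calc a * (2 * a ^ 2).choose s ≤ a * Nat.centralBinom (a ^ 2) :=
          Nat.mul_le_mul_left _ (Nat.choose_le_centralBinom _ _)
      _ ≤ 4 ^ a ^ 2 := mul_centralBinom_sq_le a
      _ = 2 ^ (2 * a ^ 2) := by rw [pow_mul]; norm_num
  | succ d _ ih =>
    cases s with
    | zero => simpa [pow_succ] using (ih 0).trans (Nat.le_mul_of_pos_right _ two_pos)
    | succ s =>
      rw [Nat.choose_succ_succ, mul_add, pow_succ, mul_two]
      exact Nat.add_le_add (ih _) (ih _)

/-- The labels `1, …, 2 * M`, encoded as a bit worth `M` and a remainder, so that the bits of a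
uniformly random labeling are independent of the remainders. -/
def bitLabel (M : ℕ) (a : Bool × Fin M) : ℕ :=
  (if a.1 then M else 0) + (a.2 + 1)

lemma bitLabel_injective (M : ℕ) : Function.Injective (bitLabel M) := by
  rintro ⟨a, i⟩ ⟨b, j⟩ h
  have := i.isLt
  have := j.isLt
  cases a <;> cases b <;> simp [bitLabel] at h ⊢ <;> omega

lemma bitLabel_mem_Icc {M : ℕ} (a : Bool × Fin M) : bitLabel M a ∈ Icc 1 (2 * M) := by
  have := a.2.isLt
  rw [mem_Icc, bitLabel]
  split_ifs <;> omega

lemma labelDiff_bitLabel {V : Type*} [DecidableEq V] {M : ℕ} (B : Finset V)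
    (g : V → Fin M) (p : Finset V × Finset V) :
    labelDiff (bitLabel M ∘ fun v => (decide (v ∈ B), g v)) p =
      M * ((#(B ∩ p.1) : ℤ) - #(B ∩ p.2)) + labelDiff (fun v => g v + 1) p := by
  have hsum : ∀ s : Finset V, ∑ v ∈ s, (bitLabel M (decide (v ∈ B), g v) : ℤ) =
      M * #(B ∩ s) + ∑ v ∈ s, ((g v + 1 : ℕ) : ℤ) := by
    intro s
    simp [bitLabel, sum_add_distrib, inter_comm, mul_comm]
  simp only [labelDiff, Function.comp_apply, hsum]
  ring

-- Replacing `B` by `B ∆ (e' \ e)` turns the signed count into the size of an intersection.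
lemma card_inter_sub_card_inter_eq {V : Type*} [DecidableEq V] (B e e' : Finset V) :
    (#(B ∩ e) : ℤ) - #(B ∩ e') = #(B ∆ (e' \ e) ∩ e ∆ e') - #(e' \ e) := by
  have hcard : ∀ s ⊆ e ∪ e', (#s : ℤ) = ∑ v ∈ e ∪ e', if v ∈ s then 1 else 0 := fun s hs => by
    simp [inter_eq_right.2 hs]
  rw [hcard (B ∩ e) (inter_subset_right.trans subset_union_left),
    hcard (B ∩ e') (inter_subset_right.trans subset_union_right),
    hcard _ (inter_subset_right.trans symmDiff_le_sup),
    hcard (e' \ e) (sdiff_subset.trans subset_union_right), ← sum_sub_distrib, ← sum_sub_distrib]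
  refine sum_congr rfl fun v _ => ?_
  by_cases hB : v ∈ B <;> by_cases he : v ∈ e <;> by_cases he' : v ∈ e' <;>
    simp [mem_symmDiff, hB, he, he']

lemma card_filter_le_card_filter_mul_le {α β : Type*} (r : α → β → Prop)
    [∀ x y, Decidable (r x y)] {S : Finset α} {T : Finset β} {d : ℕ}
    (hd : ∀ y ∈ T, #{x ∈ S | r x y} ≤ d) (b : ℕ) :
    #{x ∈ S | b ≤ #{y ∈ T | r x y}} * b ≤ #T * d :=
  card_mul_le_card_mul r (fun _ hx => (mem_filter.1 hx).2) fun y hy =>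
    (card_le_card (filter_subset_filter _ (filter_subset _ S))).trans (hd y hy)

lemma mul_card_filter_le_card_le {Ω P : Type*} [Fintype Ω] {S : Finset P} {r : Ω → P → Prop}
    [∀ ω p, Decidable (r ω p)] {b q k : ℕ} (hb : 0 < b) (hq : 0 < q) (hS : k * #S ≤ b * q)
    (hr : ∀ p ∈ S, #{ω | r ω p} * q ≤ Fintype.card Ω) :
    k * #{ω | b ≤ #{p ∈ S | r ω p}} ≤ Fintype.card Ω := by
  have hmarkov : #{ω | b ≤ #{p ∈ S | r ω p}} * b ≤ #S * (Fintype.card Ω / q) :=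
    card_filter_le_card_filter_mul_le r (fun p hp => (Nat.le_div_iff_mul_le hq).2 (hr p hp)) b
  refine Nat.le_of_mul_le_mul_right ?_ (Nat.mul_pos hb hq)
  calc k * #{ω | b ≤ #{p ∈ S | r ω p}} * (b * q)
      = k * (#{ω | b ≤ #{p ∈ S | r ω p}} * b) * q := by ring
    _ ≤ k * (#S * (Fintype.card Ω / q)) * q := by gcongr
    _ = k * #S * (Fintype.card Ω / q * q) := by ring
    _ ≤ b * q * Fintype.card Ω := Nat.mul_le_mul hS (Nat.div_mul_le_self _ _)
    _ = Fintype.card Ω * (b * q) := mul_comm _ _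

section RandomLabels

variable {V : Type*} [Fintype V] [DecidableEq V]

lemma card_labelDiff_eq_zero_mul_le {A : Type*} [Fintype A] {l : A → ℕ}
    (hl : Function.Injective l) {p : Finset V × Finset V} (hp : p.1 ≠ p.2) :
    #{f : V → A | labelDiff (l ∘ f) p = 0} * Fintype.card A ≤ Fintype.card (V → A) := by
  obtain ⟨v, hv⟩ : (p.1 ∆ p.2).Nonempty := symmDiff_nonempty.2 hp
  rw [← card_univ (α := A), ← card_product, ← card_univ]
  refine card_le_card_of_injOn (fun q => Function.update q.1 v q.2) (fun _ _ => mem_univ _) ?_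
  rintro ⟨f, a⟩ hf ⟨g, b⟩ hg hfg
  have hf0 : labelDiff (l ∘ f) p = 0 := (mem_filter.1 (mem_product.1 hf).1).2
  have hg0 : labelDiff (l ∘ g) p = 0 := (mem_filter.1 (mem_product.1 hg).1).2
  obtain ⟨hab, hne⟩ := Function.update_eq_iff.1 hfg
  have hg_eq : g = Function.update f v (g v) :=
    Function.eq_update_iff.2 ⟨rfl, fun u hu => by simpa [hu] using (hne u hu).symm⟩
  have hgv : g v = f v := by
    apply hl
    rw [← labelDiff_update_inj (l ∘ f) hv, ← Function.comp_update, ← Function.comp_update,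
      ← hg_eq, Function.update_eq_self, hf0, hg0]
  rw [hgv, Function.update_eq_self] at hg_eq
  simpa [hg_eq] using hab

lemma card_filter_card_inter_eq (D : Finset V) (s : ℕ) :
    #{B : Finset V | #(B ∩ D) = s} = (#D).choose s * 2 ^ #Dᶜ := by
  rw [← card_powersetCard, ← card_powerset, ← card_product]
  refine card_nbij' (fun B => (B ∩ D, B \ D)) (fun q => q.1 ∪ q.2) ?_ ?_ ?_ ?_
  · intro B hB
    simp_all [subset_iff]
  · rintro ⟨X, Y⟩ h
    simp only [coe_product, Set.mem_prod, mem_coe, mem_powersetCard, mem_powerset] at h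
    have hX : (X ∪ Y) ∩ D = X := by grind [mem_compl]
    simp [hX, h.1.2]
  · intro B _
    grind
  · rintro ⟨X, Y⟩ h
    simp only [coe_product, Set.mem_prod, mem_coe, mem_powersetCard, mem_powerset] at h
    have hX : (X ∪ Y) ∩ D = X := by grind [mem_compl]
    have hY : (X ∪ Y) \ D = Y := by grind [mem_compl]
    exact Prod.ext hX hY

lemma card_filter_card_inter_sub_card_inter_eq_mul_le {a : ℕ} {e e' : Finset V}
    (ha : 2 * a ^ 2 ≤ #(e ∆ e')) (t : ℤ) :
    #{B : Finset V | (#(B ∩ e) : ℤ) - #(B ∩ e') = t} * a ≤ 2 ^ Fintype.card V := by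
  set D := e ∆ e' with hD
  have hle : #{B : Finset V | (#(B ∩ e) : ℤ) - #(B ∩ e') = t} ≤
      #{B : Finset V | #(B ∩ D) = (t + #(e' \ e)).toNat} := by
    refine card_le_card_of_injOn (fun B => B ∆ (e' \ e)) (fun B hB => ?_)
      (symmDiff_left_injective (e' \ e)).injOn
    have hBt := (mem_filter.1 hB).2
    rw [card_inter_sub_card_inter_eq, ← hD] at hBt
    exact mem_filter.2 ⟨mem_univ _, by dsimp only; omega⟩
  calc #{B : Finset V | (#(B ∩ e) : ℤ) - #(B ∩ e') = t} * a
      ≤ (#D).choose (t + #(e' \ e)).toNat * 2 ^ #Dᶜ * a :=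
        Nat.mul_le_mul_right a (hle.trans_eq (card_filter_card_inter_eq D _))
    _ = a * (#D).choose (t + #(e' \ e)).toNat * 2 ^ #Dᶜ := by ring
    _ ≤ 2 ^ #D * 2 ^ #Dᶜ := Nat.mul_le_mul_right _ (mul_choose_le_two_pow ha _)
    _ = 2 ^ Fintype.card V := by rw [← pow_add, card_add_card_compl]

lemma card_filter_bool_prod_eq_sum {β : Type*} [Fintype β] (P : (V → Bool × β) → Prop)
    [DecidablePred P] :
    #{f | P f} = ∑ g : V → β, #{B : Finset V | P fun v => (decide (v ∈ B), g v)} := by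
  rw [← card_sigma]
  refine card_nbij' (fun f => ⟨fun v => (f v).2, univ.filter fun v => (f v).1 = true⟩)
    (fun q v => (decide (v ∈ q.2), q.1 v)) ?_ ?_ ?_ ?_ <;> intro _ _ <;> simp_all

-- A window of length `4 * K * M` contains at most `4 * K + 1` of the possible multiples of `M`.
lemma card_filter_abs_labelDiff_bitLabel_le_mul_le {M a : ℕ} (hM : 0 < M) (K : ℕ)
    {p : Finset V × Finset V} (ha : 2 * a ^ 2 ≤ #(p.1 ∆ p.2)) (g : V → Fin M) :
    #{B : Finset V |
      |labelDiff (bitLabel M ∘ fun v => (decide (v ∈ B), g v)) p| ≤ K * (2 * M : ℕ)} * a ≤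
      (4 * K + 1) * 2 ^ Fintype.card V := by
  set r := labelDiff (fun v => g v + 1) p
  set I := Icc (-r / M - 2 * K) (-r / M + 2 * K) with hI
  have hsub : ({B : Finset V |
      |labelDiff (bitLabel M ∘ fun v => (decide (v ∈ B), g v)) p| ≤ K * (2 * M : ℕ)} : Finset _) ⊆
      I.biUnion fun t => {B : Finset V | (#(B ∩ p.1) : ℤ) - #(B ∩ p.2) = t} := by
    intro B hB
    have hM0 : (0 : ℤ) < M := by exact_mod_cast hM
    have hwindow := (mem_filter.1 hB).2
    rw [labelDiff_bitLabel, abs_le] at hwindow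
    push_cast at hwindow
    simp only [mem_biUnion, mem_filter, mem_univ, true_and, exists_eq_right', hI, mem_Icc]
    have hdiv := Int.mul_ediv_add_emod (-r) M
    have hmod_nonneg := Int.emod_nonneg (-r) hM0.ne'
    have hmod_lt := Int.emod_lt_of_pos (-r) hM0
    constructor <;> by_contra! <;> nlinarith
  calc _ ≤ (∑ t ∈ I, #{B : Finset V | (#(B ∩ p.1) : ℤ) - #(B ∩ p.2) = t}) * a :=
        Nat.mul_le_mul_right _ ((card_le_card hsub).trans card_biUnion_le)
    _ ≤ #I * 2 ^ Fintype.card V := by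
        rw [sum_mul]
        exact sum_le_card_nsmul _ _ _ fun t _ =>
          card_filter_card_inter_sub_card_inter_eq_mul_le ha t
    _ = _ := by
        rw [hI, Int.card_Icc]
        congr 1
        omega

lemma card_abs_labelDiff_le_mul_le {M a : ℕ} (hM : 0 < M) (K : ℕ) {p : Finset V × Finset V}
    (ha : 2 * a ^ 2 ≤ #(p.1 ∆ p.2)) :
    #{f : V → Bool × Fin M | |labelDiff (bitLabel M ∘ f) p| ≤ K * (2 * M : ℕ)} * a ≤
      (4 * K + 1) * Fintype.card (V → Bool × Fin M) := by
  rw [card_filter_bool_prod_eq_sum, sum_mul]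
  calc _ ≤ ∑ _g : V → Fin M, (4 * K + 1) * 2 ^ Fintype.card V :=
        sum_le_sum fun g _ => card_filter_abs_labelDiff_bitLabel_le_mul_le hM K ha g
    _ = (4 * K + 1) * Fintype.card (V → Bool × Fin M) := by
        simp [mul_pow]
        ring

end RandomLabels
lemma exists_label_range_and_threshold {C m : ℕ} (hC : 0 < C) (hm : 8 * C ≤ m) :
    ∃ M b : ℕ, 0 < M ∧ 0 < b ∧ 2 * M * C ≤ m ^ 2 ∧ m ^ 2 ≤ 4 * C * M ∧ m ^ 2 ≤ 8 * C * b ∧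
      2 * b ≤ M + 2 := by
  have hM_le : m ^ 2 / (2 * C) * (2 * C) ≤ m ^ 2 := Nat.div_mul_le_self _ _
  have hM_lt : m ^ 2 < 2 * C * (m ^ 2 / (2 * C) + 1) := Nat.lt_mul_div_succ _ (by positivity)
  have hM_pos : 0 < m ^ 2 / (2 * C) := Nat.div_pos (by nlinarith) (by positivity)
  have hEM : m ^ 2 ≤ 4 * C * (m ^ 2 / (2 * C)) := by nlinarith
  have hb_le : 8 * C * (m ^ 2 / (8 * C)) ≤ m ^ 2 := Nat.mul_div_le _ _
  refine ⟨m ^ 2 / (2 * C), m ^ 2 / (8 * C) + 1, hM_pos, Nat.succ_pos _, by linarith, hEM,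
    (Nat.lt_mul_div_succ _ (by positivity)).le, ?_⟩
  have : 2 * (m ^ 2 / (8 * C)) ≤ m ^ 2 / (2 * C) :=
    Nat.le_of_mul_le_mul_left (show 4 * C * _ ≤ 4 * C * _ by linarith) (by positivity)
  omega

lemma card_offDiag_filter_le_sq {α : Type*} (E : Finset α) (P : α × α → Prop)
    [DecidablePred P] : #{p ∈ E.offDiag | P p} ≤ #E ^ 2 := by
  refine (card_filter_le _ _).trans ?_
  rw [offDiag_card, sq]
  exact Nat.sub_le _ _

lemma exists_not_of_four_mul_card_le {Ω : Type*} [Fintype Ω] [Nonempty Ω] {P Q R : Ω → Prop}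
    [DecidablePred P] [DecidablePred Q] [DecidablePred R]
    (hP : 4 * #{ω | P ω} ≤ Fintype.card Ω) (hQ : 4 * #{ω | Q ω} ≤ Fintype.card Ω)
    (hR : 4 * #{ω | R ω} ≤ Fintype.card Ω) : ∃ ω, ¬ P ω ∧ ¬ Q ω ∧ ¬ R ω := by
  classical
  by_contra! hcover
  have hunion : univ ⊆ ((univ.filter fun ω => P ω) ∪ univ.filter fun ω => Q ω) ∪
      univ.filter fun ω => R ω := fun ω _ => by
    have := hcover ω
    grind
  have hle := (card_le_card hunion).trans
    ((card_union_le _ _).trans (Nat.add_le_add_right (card_union_le _ _) _))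
  have hpos := Fintype.card_pos (α := Ω)
  rw [card_univ] at hle
  omega

section UpperBound

variable {V : Type*} [DecidableEq V]

lemma four_mul_card_le_card_filter_labelDiff_eq_zero_le [Fintype V] {M b : ℕ} (hM : 0 < M)
    (hb : 0 < b) {S : Finset (Finset V × Finset V)} (hS : ∀ p ∈ S, p.1 ≠ p.2)
    (hSb : 4 * #S ≤ b * (2 * M)) :
    4 * #{f : V → Bool × Fin M | b ≤ #{p ∈ S | labelDiff (bitLabel M ∘ f) p = 0}} ≤
      Fintype.card (V → Bool × Fin M) := by
  refine mul_card_filter_le_card_le hb (by positivity) hSb fun p hp => ?_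
  simpa using card_labelDiff_eq_zero_mul_le (bitLabel_injective M) (hS p hp)

lemma four_mul_card_le_card_filter_abs_labelDiff_le [Fintype V] {M C K b a : ℕ} (hM : 0 < M)
    (hb : 0 < b) (hC : 0 < C) {E : Finset (Finset V)} (hEb : #E ^ 2 ≤ 8 * C * b)
    (ha : 32 * C * (4 * K + 1) ≤ a) :
    4 * #{f : V → Bool × Fin M | b ≤ #{p ∈ {p ∈ E.offDiag | 2 * a ^ 2 ≤ #(p.1 ∆ p.2)} |
      |labelDiff (bitLabel M ∘ f) p| ≤ K * (2 * M : ℕ)}} ≤ Fintype.card (V → Bool × Fin M) := by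
  have hS := card_offDiag_filter_le_sq E fun p => 2 * a ^ 2 ≤ #(p.1 ∆ p.2)
  refine mul_card_filter_le_card_le hb (q := 32 * C) (by positivity) (by nlinarith) fun p hp => ?_
  have hsmall := card_abs_labelDiff_le_mul_le hM K (mem_filter.1 hp).2
  refine Nat.le_of_mul_le_mul_right ?_ (show 0 < 4 * K + 1 by omega)
  calc _ ≤ _ * a := by rw [mul_assoc]; exact Nat.mul_le_mul_left _ ha
    _ ≤ _ := hsmall.trans_eq (mul_comm _ _)

lemma exists_labeling_few_collisions [Finite V] {E : Finset (Finset V)} {W : Finset V} {C M b a : ℕ}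
    (hM : 0 < M) (hb : 0 < b) (hC : 0 < C) (hEM : #E ^ 2 ≤ 4 * C * M) (hEb : #E ^ 2 ≤ 8 * C * b)
    (hW : 8 * C * 2 ^ #W ≤ #E) (ha : 32 * C * (4 * (8 * C) + 1) ≤ a) :
    ∃ f : V → ℕ, (∀ v, f v ∈ Icc 1 (2 * M)) ∧ #(collisions E f) ≤ 8 * C ∧
      (∀ p ∈ collisions E f, ¬ p.1 ∆ p.2 ⊆ W) ∧
      #{p ∈ {p ∈ E.offDiag | 2 * a ^ 2 ≤ #(p.1 ∆ p.2)} |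
        |labelDiff f p| ≤ (8 * C : ℕ) * (2 * M : ℕ)} < b := by
  cases nonempty_fintype V
  have hmany := four_mul_card_le_card_filter_labelDiff_eq_zero_le (b := 8 * C) hM (by positivity)
    (S := E.offDiag) (fun p hp => (mem_offDiag.1 hp).2.2) (by
      have := card_offDiag_filter_le_sq E fun _ => True
      rw [filter_true] at this
      nlinarith)
  have hinside := four_mul_card_le_card_filter_labelDiff_eq_zero_le (b := 1) hM one_pos
    (S := {p ∈ E.offDiag | p.1 ∆ p.2 ⊆ W}) (fun p hp => (mem_offDiag.1 (mem_filter.1 hp).1).2.2) (by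
      have h₁ := card_filter_symmDiff_subset_le E W
      have h₂ : #{p ∈ E.offDiag | p.1 ∆ p.2 ⊆ W} * (8 * C) ≤ #E ^ 2 := by nlinarith
      refine Nat.le_of_mul_le_mul_right (c := 2 * C) ?_ (by positivity)
      linarith)
  have hclose := four_mul_card_le_card_filter_abs_labelDiff_le hM hb hC hEb ha
  have : Nonempty (Fin M) := ⟨⟨0, hM⟩⟩
  obtain ⟨f, hfew, hfW, hfar⟩ := exists_not_of_four_mul_card_le hmany hinside hclose
  refine ⟨bitLabel M ∘ f, fun v => bitLabel_mem_Icc _, (not_le.1 hfew).le, fun p hp hpW => ?_,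
    not_le.1 hfar⟩
  obtain ⟨hpE, hp0⟩ := mem_filter.1 hp
  exact hfW (card_pos.2 ⟨p, mem_filter.2 ⟨mem_filter.2 ⟨hpE, hpW⟩, hp0⟩⟩)

lemma exists_card_le_forall_notMem_card_lt [Finite V] {A : Finset (Finset V × Finset V)}
    {b d k : ℕ} (hb : 0 < b) (hA : #A ≤ k * b) (hd : ∀ p ∈ A, #(p.1 ∆ p.2) ≤ d) :
    ∃ W : Finset V, #W ≤ k * d ∧ ∀ v ∉ W, #{p ∈ A | v ∈ p.1 ∆ p.2} < b := by
  cases nonempty_fintype V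
  have hdouble : #{v | b ≤ #{p ∈ A | v ∈ p.1 ∆ p.2}} * b ≤ #A * d :=
    card_filter_le_card_filter_mul_le (S := univ)
      (fun (v : V) (p : Finset V × Finset V) => v ∈ p.1 ∆ p.2) (by simpa using hd) b
  refine ⟨univ.filter fun v => b ≤ #{p ∈ A | v ∈ p.1 ∆ p.2}, Nat.le_of_mul_le_mul_right ?_ hb,
    fun v hv => by simpa using hv⟩
  calc _ ≤ #A * d := hdouble
    _ ≤ k * b * d := Nat.mul_le_mul_right _ hA
    _ = k * d * b := by ring

lemma exists_collisions_eq_empty {C : ℕ} (hC : 0 < C) :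
    ∃ m₀ : ℕ, ∀ {V : Type*} [Finite V] (E : Finset (Finset V)), m₀ ≤ #E →
      ∃ g : V → ℕ, (∀ v, 1 ≤ g v ∧ g v * C ≤ #E ^ 2) ∧ collisions E g = ∅ := by
  obtain ⟨a, ha⟩ : ∃ a, 32 * C * (4 * (8 * C) + 1) ≤ a := ⟨_, le_rfl⟩
  refine ⟨8 * C * 2 ^ (8 * C * (2 * a ^ 2)), fun {V} _ E hE => ?_⟩
  classical
  obtain ⟨M, b, hM, hb, hMC, hEM, hEb, hbM⟩ := exists_label_range_and_threshold hC
    ((Nat.le_mul_of_pos_right _ (by positivity)).trans hE)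
  obtain ⟨W, hWcard, hW⟩ := exists_card_le_forall_notMem_card_lt
    (A := {p ∈ E.offDiag | #(p.1 ∆ p.2) ≤ 2 * a ^ 2}) hb
    ((card_offDiag_filter_le_sq E _).trans hEb) fun p hp => (mem_filter.1 hp).2
  have hWE : 8 * C * 2 ^ #W ≤ #E :=
    (Nat.mul_le_mul_left _ (Nat.pow_le_pow_right two_pos hWcard)).trans hE
  obtain ⟨f, hf, hfew, hfW, hfar⟩ :=
    exists_labeling_few_collisions hM hb hC hEM hEb hWE ha
  obtain ⟨g, hg, hg0⟩ := exists_collisions_eq_empty_of_card_collisions_le hf hfew hfW fun v hv => by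
    have hsub : {p ∈ E.offDiag | v ∈ p.1 ∆ p.2 ∧ |labelDiff f p| ≤ (8 * C : ℕ) * (2 * M : ℕ)} ⊆
        {p ∈ {p ∈ E.offDiag | #(p.1 ∆ p.2) ≤ 2 * a ^ 2} | v ∈ p.1 ∆ p.2} ∪
          {p ∈ {p ∈ E.offDiag | 2 * a ^ 2 ≤ #(p.1 ∆ p.2)} |
            |labelDiff f p| ≤ (8 * C : ℕ) * (2 * M : ℕ)} := fun p hp => by
      have := le_total #(p.1 ∆ p.2) (2 * a ^ 2)
      simp only [mem_union, mem_filter] at hp ⊢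
      tauto
    have hle := (card_le_card hsub).trans (card_union_le _ _)
    have hnear := hW v hv
    omega
  refine ⟨g, fun v => ⟨(mem_Icc.1 (hg v)).1, ?_⟩, hg0⟩
  exact (Nat.mul_le_mul_right C (mem_Icc.1 (hg v)).2).trans hMC

end UpperBound

section SeparatedFamilies

variable {α β : Type*}

/-- The families of `m` members of `P` to which `σ` assigns pairwise distinct values. -/
noncomputable def separatedFamilies (P : Finset α) (σ : α → β) (m : ℕ) : Finset (Finset α) :=
  open scoped Classical in {F ∈ P.powersetCard m | Set.InjOn σ F}

lemma mem_separatedFamilies {P : Finset α} {σ : α → β} {m : ℕ} {F : Finset α} :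
    F ∈ separatedFamilies P σ m ↔ F ∈ P.powersetCard m ∧ Set.InjOn σ F := by
  simp [separatedFamilies]

lemma card_filter_image_eq_le_prod [DecidableEq β] (P : Finset α) (σ : α → β) (m : ℕ)
    (T : Finset β) :
    #{F ∈ separatedFamilies P σ m | F.image σ = T} ≤ ∏ s ∈ T, #{e ∈ P | σ e = s} := by
  classical
  rw [← card_pi T fun s => {e ∈ P | σ e = s}]
  refine card_le_card_of_surjOn (fun φ => T.attach.image fun s => φ s.1 s.2) fun F hF => ?_
  obtain ⟨hFsep, rfl⟩ := mem_filter.1 hF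
  obtain ⟨hFP, hinj⟩ := mem_separatedFamilies.1 hFsep
  choose φ hφF hφ using fun s (hs : s ∈ F.image σ) => mem_image.1 hs
  refine ⟨φ, mem_pi.2 fun s hs => mem_filter.2
    ⟨(mem_powersetCard.1 hFP).1 (hφF s hs), hφ s hs⟩, ?_⟩
  ext e
  simp only [mem_image, mem_attach, true_and, Subtype.exists]
  constructor
  · rintro ⟨s, hs, rfl⟩
    exact hφF s (mem_image.2 hs)
  · intro he
    have hs : σ e ∈ F.image σ := mem_image_of_mem σ he
    exact ⟨σ e, mem_image.1 hs, hinj (hφF _ hs) he (hφ _ hs)⟩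

lemma card_separatedFamilies_le_sum_prod [DecidableEq β] {P : Finset α} {σ : α → β} {S : Finset β}
    (hσ : ∀ e ∈ P, σ e ∈ S) (m : ℕ) :
    #(separatedFamilies P σ m) ≤ ∑ T ∈ S.powersetCard m, ∏ s ∈ T, #{e ∈ P | σ e = s} := by
  have hmaps : ∀ F ∈ separatedFamilies P σ m, F.image σ ∈ S.powersetCard m := by
    intro F hF
    obtain ⟨hFP, hinj⟩ := mem_separatedFamilies.1 hF
    obtain ⟨hFP, hFm⟩ := mem_powersetCard.1 hFP
    exact mem_powersetCard.2
      ⟨image_subset_iff.2 fun e he => hσ e (hFP he), (card_image_of_injOn hinj).trans hFm⟩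
  rw [card_eq_sum_card_fiberwise hmaps]
  exact sum_le_sum fun T _ => card_filter_image_eq_le_prod P σ m T

lemma prod_one_add_le_one_add_average_pow {ι : Type*} {S : Finset ι} {y : ι → ℝ}
    (hS : S.Nonempty) (hy : ∀ s ∈ S, 0 ≤ y s) :
    ∏ s ∈ S, (1 + y s) ≤ (1 + (∑ s ∈ S, y s) / #S) ^ #S := by
  have hS0 : 0 < #S := hS.card_pos
  have hpos : ∀ s ∈ S, 0 ≤ 1 + y s := fun s hs => by linarith [hy s hs]
  have hamgm := Real.geom_mean_le_arith_mean S 1 (fun s => 1 + y s) (by simp) (by simpa) hpos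
  simp only [Pi.one_apply, Real.rpow_one, sum_const, nsmul_one, one_mul, sum_add_distrib] at hamgm
  rw [add_div, div_self (by positivity)] at hamgm
  have hle := pow_le_pow_left₀ (Real.rpow_nonneg (prod_nonneg hpos) _) hamgm #S
  rwa [Real.rpow_inv_natCast_pow (prod_nonneg hpos) hS0.ne'] at hle

lemma one_add_le_exp_sub_sq {t : ℝ} (h0 : 0 ≤ t) (h1 : t ≤ 1) :
    1 + t ≤ Real.exp (t - t ^ 2 / 4) := by
  have hquad := Real.quadratic_le_exp_of_nonneg (show 0 ≤ t - t ^ 2 / 4 by nlinarith)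
  have hhalf : 1 / 2 ≤ (1 - t / 4) ^ 2 := by nlinarith
  nlinarith [mul_le_mul_of_nonneg_left hhalf (sq_nonneg t)]

-- The left side is the `m`-th coefficient of `∏ s ∈ S, (1 + c s * X)`; evaluate this polynomial at
-- `m / ∑ s ∈ S, c s`.
lemma sum_powersetCard_prod_le {ι : Type*} {S : Finset ι} {c : ι → ℝ} {m : ℕ}
    (hc : ∀ s ∈ S, 0 ≤ c s) (hsum : 0 < ∑ s ∈ S, c s) (hm : 0 < m) (hmS : m ≤ #S) :
    ∑ T ∈ S.powersetCard m, ∏ s ∈ T, c s ≤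
      ((∑ s ∈ S, c s) / m) ^ m * Real.exp (m - (m : ℝ) ^ 2 / (4 * #S)) := by
  set total := ∑ s ∈ S, c s with htotal
  set x : ℝ := m / total with hx
  have hx0 : 0 ≤ x := by positivity
  have hS0 : 0 < #S := hm.trans_le hmS
  have hxc : ∀ s ∈ S, 0 ≤ x * c s := fun s hs => mul_nonneg hx0 (hc s hs)
  have hcoeff : (∑ T ∈ S.powersetCard m, ∏ s ∈ T, c s) * x ^ m ≤ ∏ s ∈ S, (1 + x * c s) := by
    calc (∑ T ∈ S.powersetCard m, ∏ s ∈ T, c s) * x ^ m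
        = ∑ T ∈ S.powersetCard m, ∏ s ∈ T, (x * c s) := by
          rw [sum_mul]
          refine sum_congr rfl fun T hT => ?_
          rw [prod_mul_distrib, prod_const, (mem_powersetCard.1 hT).2, mul_comm]
      _ ≤ ∑ T ∈ S.powerset, ∏ s ∈ T, (x * c s) :=
          sum_le_sum_of_subset_of_nonneg (fun T hT => mem_powerset.2 (mem_powersetCard.1 hT).1)
            fun T hT _ => prod_nonneg fun s hs => hxc s (mem_powerset.1 hT hs)
      _ = ∏ s ∈ S, (1 + x * c s) := (prod_one_add S).symm
  have hexp : ∏ s ∈ S, (1 + x * c s) ≤ Real.exp (m - (m : ℝ) ^ 2 / (4 * #S)) := by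
    calc ∏ s ∈ S, (1 + x * c s) ≤ (1 + (∑ s ∈ S, x * c s) / #S) ^ #S :=
          prod_one_add_le_one_add_average_pow (card_pos.1 hS0) hxc
      _ = (1 + (m : ℝ) / #S) ^ #S := by
          rw [← mul_sum, ← htotal, hx, div_mul_cancel₀ _ hsum.ne']
      _ ≤ Real.exp ((m : ℝ) / #S - ((m : ℝ) / #S) ^ 2 / 4) ^ #S := by
          refine pow_le_pow_left₀ (by positivity) (one_add_le_exp_sub_sq (by positivity) ?_) _
          exact div_le_one_of_le₀ (by exact_mod_cast hmS) (by positivity)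
      _ = Real.exp (m - (m : ℝ) ^ 2 / (4 * #S)) := by
          rw [← Real.exp_nat_mul]
          congr 1
          field_simp
  have hle := hcoeff.trans hexp
  rwa [← le_div_iff₀ (by positivity), div_eq_inv_mul, ← inv_pow, hx, inv_div] at hle

lemma card_separatedFamilies_le {P : Finset α} {σ : α → β} {S : Finset β} {m : ℕ}
    (hσ : ∀ e ∈ P, σ e ∈ S) (hP : P.Nonempty) (hm : 0 < m) (hmS : m ≤ #S) :
    (#(separatedFamilies P σ m) : ℝ) ≤
      ((#P : ℝ) / m) ^ m * Real.exp (m - (m : ℝ) ^ 2 / (4 * #S)) := by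
  classical
  have hsum : ∑ s ∈ S, (#{e ∈ P | σ e = s} : ℝ) = #P := by
    rw [card_eq_sum_card_fiberwise hσ, Nat.cast_sum]
  have hP0 : (0 : ℝ) < #P := by exact_mod_cast hP.card_pos
  calc (#(separatedFamilies P σ m) : ℝ)
      ≤ ∑ T ∈ S.powersetCard m, ∏ s ∈ T, (#{e ∈ P | σ e = s} : ℝ) := by
        exact_mod_cast card_separatedFamilies_le_sum_prod hσ m
    _ ≤ _ := hsum ▸ sum_powersetCard_prod_le (fun s _ => by positivity) (by rwa [hsum]) hm hmS

lemma factorial_mul_exp_le {m : ℕ} (hm : 0 < m) :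
    (m.factorial : ℝ) * Real.exp m ≤ 3 * m * (m : ℝ) ^ m := by
  have hm1 : (1 : ℝ) ≤ m := by exact_mod_cast hm
  have hstirling : Stirling.stirlingSeq m ≤ Real.exp 1 / √2 := by
    rw [← Stirling.stirlingSeq_one, ← Nat.succ_pred_eq_of_pos hm]
    exact Stirling.stirlingSeq'_antitone (Nat.zero_le _)
  have hsqrt : √(m : ℝ) ≤ m := Real.sqrt_le_self_iff.2 (Or.inr hm1)
  calc (m.factorial : ℝ) * Real.exp m
      = Stirling.stirlingSeq m * √2 * √m * (m : ℝ) ^ m := by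
        rw [Stirling.stirlingSeq, Real.sqrt_mul zero_le_two, div_pow,
          ← Real.exp_nat_mul, mul_one]
        field_simp
    _ ≤ Real.exp 1 / √2 * √2 * m * (m : ℝ) ^ m := by gcongr
    _ = Real.exp 1 * m * (m : ℝ) ^ m := by rw [div_mul_cancel₀ _ (by positivity)]
    _ ≤ 3 * m * (m : ℝ) ^ m := by gcongr; exact Real.exp_one_lt_three.le

lemma pow_le_two_mul_factorial_mul_choose {M m : ℕ} (hM : 2 * m ^ 2 ≤ M) :
    (M : ℝ) ^ m ≤ 2 * m.factorial * M.choose m := by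
  obtain rfl | hm := m.eq_zero_or_pos
  · norm_num
  have hM' : (2 * m ^ 2 : ℝ) ≤ M := by exact_mod_cast hM
  have hM0 : (0 : ℝ) < M := lt_of_lt_of_le (by positivity) hM'
  have hmM : m ≤ M := by nlinarith
  have hdesc : ((M : ℝ) - m) ^ m ≤ m.factorial * M.choose m := by
    rw [← Nat.cast_sub hmM]
    have := (Nat.pow_le_pow_left (show M - m ≤ M + 1 - m by omega) m).trans
      (Nat.pow_sub_le_descFactorial M m)
    rw [Nat.descFactorial_eq_factorial_mul_choose] at this
    exact_mod_cast this
  have hratio : (m : ℝ) / M ≤ 1 := div_le_one_of_le₀ (by exact_mod_cast hmM) hM0.le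
  have hbernoulli : (1 : ℝ) / 2 ≤ (1 + -((m : ℝ) / M)) ^ m := by
    refine le_trans ?_ (one_add_mul_le_pow (by linarith) m)
    have : (m : ℝ) * ((m : ℝ) / M) ≤ 1 / 2 := by
      rw [mul_div_assoc', div_le_iff₀ hM0]
      linarith
    linarith
  calc (M : ℝ) ^ m = 2 * (M ^ m * (1 / 2)) := by ring
    _ ≤ 2 * (M ^ m * (1 + -((m : ℝ) / M)) ^ m) := by gcongr
    _ = 2 * ((M : ℝ) - m) ^ m := by
        rw [← mul_pow, mul_add, mul_one, mul_neg, mul_div_cancel₀ _ hM0.ne', sub_eq_add_neg]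
    _ ≤ 2 * m.factorial * M.choose m := by linarith

lemma exists_forall_not_injOn {ι : Type*} {P : Finset α} {S : Finset β} {L : Finset ι}
    {σ : ι → α → β} {m : ℕ} (hσ : ∀ i ∈ L, ∀ e ∈ P, σ i e ∈ S) (hm : 0 < m) (hmS : m ≤ #S)
    (hP : 2 * m ^ 2 ≤ #P) (hL : 6 * m * (#L : ℝ) < Real.exp ((m : ℝ) ^ 2 / (4 * #S))) :
    ∃ F ∈ P.powersetCard m, ∀ i ∈ L, ¬ Set.InjOn (σ i) F := by
  classical
  by_contra! hcover
  have hP0 : 0 < #P := hP.trans_lt' (by positivity)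
  set D := (m : ℝ) ^ 2 / (4 * #S)
  have hchoose : ((#P).choose m : ℝ) ≤ #L * (((#P : ℝ) / m) ^ m * Real.exp (m - D)) := by
    have hsub : P.powersetCard m ⊆ L.biUnion fun i => separatedFamilies P (σ i) m := fun F hF => by
      obtain ⟨i, hi, hinj⟩ := hcover F hF
      exact mem_biUnion.2 ⟨i, hi, mem_separatedFamilies.2 ⟨hF, hinj⟩⟩
    have hunion := (card_le_card hsub).trans card_biUnion_le
    rw [card_powersetCard] at hunion
    calc ((#P).choose m : ℝ) ≤ ∑ i ∈ L, (#(separatedFamilies P (σ i) m) : ℝ) := by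
          exact_mod_cast hunion
      _ ≤ _ := sum_le_card_nsmul _ _ _ fun i hi =>
          card_separatedFamilies_le (hσ i hi) (card_pos.1 hP0) hm hmS
      _ = _ := nsmul_eq_mul _ _
  have hle : (#P : ℝ) ^ m * Real.exp D ≤ (#P : ℝ) ^ m * (6 * m * #L) := by
    calc (#P : ℝ) ^ m * Real.exp D
        ≤ 2 * m.factorial * (#L * (((#P : ℝ) / m) ^ m * Real.exp (m - D))) * Real.exp D := by
          gcongr
          exact (pow_le_two_mul_factorial_mul_choose hP).trans (by gcongr)
      _ = 2 * #L * ((#P : ℝ) / m) ^ m * (m.factorial * Real.exp m) := by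
          rw [Real.exp_sub]
          field_simp
      _ ≤ 2 * #L * ((#P : ℝ) / m) ^ m * (3 * m * (m : ℝ) ^ m) :=
          mul_le_mul_of_nonneg_left (factorial_mul_exp_le hm) (by positivity)
      _ = _ := by rw [div_pow]; field_simp; ring
  exact hL.not_ge (le_of_mul_le_mul_left hle (by positivity))

end SeparatedFamilies

lemma exists_family_sum_not_injOn {V : Type*} {U : Finset V} {k N m : ℕ}
    (hk : 0 < k) (hm : 0 < m) (hmN : m ≤ k * N) (hU : 2 * m ^ 2 ≤ (#U).choose k)
    (hexp : 6 * m * (N : ℝ) ^ #U < Real.exp ((m : ℝ) ^ 2 / (4 * (k * N : ℕ)))) :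
    ∃ F ∈ (U.powersetCard k).powersetCard m, ∀ f : V → ℕ, (∀ v, f v ∈ Icc 1 N) →
      ¬ Set.InjOn (fun e : Finset V => ∑ v ∈ e, f v) F := by
  classical
  have hσ : ∀ φ ∈ U.pi fun _ => Icc 1 N, ∀ e ∈ U.powersetCard k,
      ∑ v ∈ e, (if hv : v ∈ U then φ v hv else 0) ∈ Icc 1 (k * N) := by
    intro φ hφ e he
    obtain ⟨heU, rfl⟩ := mem_powersetCard.1 he
    have hlabel : ∀ v ∈ e, 1 ≤ (if hv : v ∈ U then φ v hv else 0) ∧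
        (if hv : v ∈ U then φ v hv else 0) ≤ N := fun v hv => by
      rw [dif_pos (heU hv)]
      exact mem_Icc.1 (mem_pi.1 hφ v (heU hv))
    have hlow := card_nsmul_le_sum e _ 1 fun v hv => (hlabel v hv).1
    have hhigh := sum_le_card_nsmul e _ N fun v hv => (hlabel v hv).2
    rw [smul_eq_mul] at hlow hhigh
    exact mem_Icc.2 ⟨by omega, hhigh⟩
  obtain ⟨F, hF, hinj⟩ := exists_forall_not_injOn hσ hm (by simpa) (by simpa)
    (by simpa [card_pi] using hexp)
  refine ⟨F, hF, fun f hf hfinj => hinj (fun v _ => f v) (mem_pi.2 fun v _ => hf v) ?_⟩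
  refine hfinj.congr fun e he => sum_congr rfl fun v hv => ?_
  have heU := (mem_powersetCard.1 ((mem_powersetCard.1 hF).1 he)).1
  rw [dif_pos (heU hv)]

section Parameters

open Filter

lemma eventually_two_mul_sq_le_choose_ceil_rpow {δ : ℝ} {k : ℕ} (hδ : 0 < δ) (hk : 2 < δ * k) :
    ∀ᶠ m : ℕ in atTop, 2 * m ^ 2 ≤ ⌈(m : ℝ) ^ δ⌉₊.choose k := by
  have hcast := tendsto_natCast_atTop_atTop (R := ℝ)
  have hceil : Tendsto (fun m : ℕ => ⌈(m : ℝ) ^ δ⌉₊) atTop atTop :=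
    tendsto_nat_ceil_atTop.comp ((tendsto_rpow_atTop hδ).comp hcast)
  obtain ⟨c, hc, hchoose⟩ := ((isTheta_choose k).2.comp_tendsto hceil).exists_pos
  have hgrow : ∀ᶠ m : ℕ in atTop, 2 * c ≤ (m : ℝ) ^ (δ * k - 2) :=
    ((tendsto_rpow_atTop (sub_pos.2 hk)).comp hcast).eventually_ge_atTop _
  filter_upwards [hchoose.bound, hgrow, eventually_gt_atTop 0] with m hm hmc hm0
  have hm0' : (0 : ℝ) < m := by exact_mod_cast hm0
  simp only [Function.comp_apply, norm_pow, Real.norm_natCast] at hm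
  have hle : c * (2 * m ^ 2 : ℝ) ≤ c * ⌈(m : ℝ) ^ δ⌉₊.choose k := by
    calc c * (2 * m ^ 2 : ℝ) = 2 * c * (m : ℝ) ^ (2 : ℝ) := by rw [Real.rpow_two]; ring
      _ ≤ (m : ℝ) ^ (δ * k - 2) * (m : ℝ) ^ (2 : ℝ) := by gcongr
      _ = ((m : ℝ) ^ δ) ^ k := by
          rw [← Real.rpow_add hm0', sub_add_cancel, Real.rpow_mul_natCast hm0'.le]
      _ ≤ (⌈(m : ℝ) ^ δ⌉₊ : ℝ) ^ k := by gcongr; exact Nat.le_ceil _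
      _ ≤ c * ⌈(m : ℝ) ^ δ⌉₊.choose k := hm
  exact_mod_cast le_of_mul_le_mul_left hle hc

lemma eventually_log_add_mul_log_lt_rpow_div {ε c : ℝ} (hε : 0 < ε) (hc : 0 < c) :
    ∀ᶠ x : ℝ in atTop, Real.log (6 * x) + (x ^ (ε / 2) + 1) * (2 * Real.log x) < x ^ ε / c := by
  have hlog := (isLittleO_log_rpow_atTop (half_pos hε)).bound (show 0 < 1 / (12 * c) by positivity)
  filter_upwards [hlog, eventually_ge_atTop 6] with x hx hx6
  have hlog0 : 0 ≤ Real.log x := Real.log_nonneg (by linarith)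
  have hpow1 : 1 ≤ x ^ (ε / 2) := Real.one_le_rpow (by linarith) (by positivity)
  rw [Real.norm_of_nonneg hlog0, Real.norm_of_nonneg (by positivity)] at hx
  have hlog6 : Real.log (6 * x) ≤ 2 * Real.log x := by
    rw [Real.log_mul (by norm_num) (by positivity)]
    linarith [Real.log_le_log (by norm_num) hx6]
  calc Real.log (6 * x) + (x ^ (ε / 2) + 1) * (2 * Real.log x)
      ≤ 6 * x ^ (ε / 2) * Real.log x := by nlinarith
    _ ≤ 6 * x ^ (ε / 2) * (1 / (12 * c) * x ^ (ε / 2)) := by gcongr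
    _ = x ^ ε / c / 2 := by
        rw [← add_halves ε, Real.rpow_add (by positivity), add_halves]
        field_simp
        norm_num
    _ < x ^ ε / c := half_lt_self (by positivity)

lemma eventually_mul_floor_pow_ceil_lt_exp {ε : ℝ} {k : ℕ} (hε : 0 < ε) (hε2 : ε ≤ 2)
    (hk : 0 < k) :
    ∀ᶠ m : ℕ in atTop, 6 * m * (⌊(m : ℝ) ^ (2 - ε)⌋₊ : ℝ) ^ ⌈(m : ℝ) ^ (ε / 2)⌉₊ <
      Real.exp ((m : ℝ) ^ 2 / (4 * (k * ⌊(m : ℝ) ^ (2 - ε)⌋₊ : ℕ))) := by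
  have hlog := tendsto_natCast_atTop_atTop.eventually
    (eventually_log_add_mul_log_lt_rpow_div hε (show (0 : ℝ) < 4 * k by positivity))
  filter_upwards [hlog, eventually_ge_atTop 1] with m hm hm1
  have hm1' : (1 : ℝ) ≤ m := by exact_mod_cast hm1
  have hm0 : (0 : ℝ) < m := by linarith
  set N := ⌊(m : ℝ) ^ (2 - ε)⌋₊
  have hNle : (N : ℝ) ≤ (m : ℝ) ^ (2 - ε) := Nat.floor_le (by positivity)
  have hN0 : (0 : ℝ) < N := by
    exact_mod_cast Nat.floor_pos.2 (Real.one_le_rpow hm1' (by linarith))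
  have hlogN : Real.log N ≤ 2 * Real.log m := by
    calc Real.log N ≤ Real.log ((m : ℝ) ^ (2 - ε)) := Real.log_le_log hN0 hNle
      _ = (2 - ε) * Real.log m := Real.log_rpow hm0 _
      _ ≤ 2 * Real.log m := by gcongr; linarith
  rw [← Real.log_lt_iff_lt_exp (by positivity), Real.log_mul (by positivity) (by positivity),
    Real.log_pow]
  calc Real.log (6 * m) + ⌈(m : ℝ) ^ (ε / 2)⌉₊ * Real.log N
      ≤ Real.log (6 * m) + ((m : ℝ) ^ (ε / 2) + 1) * (2 * Real.log m) := by
        gcongr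
        exact (Nat.ceil_lt_add_one (by positivity)).le
    _ < (m : ℝ) ^ ε / (4 * k) := hm
    _ = (m : ℝ) ^ 2 / (4 * (k * (m : ℝ) ^ (2 - ε))) := by
        rw [Real.rpow_sub hm0, Real.rpow_two]
        field_simp
    _ ≤ (m : ℝ) ^ 2 / (4 * (k * N : ℕ)) := by
        push_cast
        gcongr

end Parameters

section SumDistNumber

variable {V : Type*}

lemma injOn_sum_of_collisions_eq_empty {E : Finset (Finset V)} {f : V → ℕ}
    (hf : collisions E f = ∅) : Set.InjOn (fun e : Finset V => ∑ v ∈ e, f v) E := by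
  intro e he e' he' hsum
  by_contra hne
  have hmem : (e, e') ∈ collisions E f :=
    mem_filter.2 ⟨mem_offDiag.2 ⟨he, he', hne⟩, sub_eq_zero.2 (by exact_mod_cast hsum)⟩
  simp [hf] at hmem

lemma isSumDistinguishing_iff_injOn {H : Hypergraph V} {E : Finset (Finset V)}
    (hE : H.edgeSet = (fun e : Finset V => (e : Set V)) '' E) (f : V → ℕ) :
    H.IsSumDistinguishing f ↔ (∀ v ∈ H.vertexSet, 1 ≤ f v) ∧
      Set.InjOn (fun e : Finset V => ∑ v ∈ e, f v) E := by
  refine and_congr_right' ?_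
  simp only [hE, Set.forall_mem_image, Hypergraph.labelSum, finsum_mem_coe_finset, ne_eq, coe_inj]
  exact forall₄_congr fun _ _ _ _ => not_imp_not

lemma exists_sumDistValues_mul_le {C : ℕ} (hC : 0 < C) :
    ∃ m₀ : ℕ, ∀ n m : ℕ, m₀ ≤ m → ∀ s ∈ Hypergraph.sumDistValues n m, s * C ≤ m ^ 2 := by
  classical
  obtain ⟨m₀, hlabel⟩ := exists_collisions_eq_empty hC
  refine ⟨m₀, ?_⟩
  rintro n m hm _ ⟨H, -, -, rfl, rfl⟩
  let E : Finset (Finset (Fin n)) := {e | (e : Set (Fin n)) ∈ H.edgeSet}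
  have hE : H.edgeSet = (fun e : Finset (Fin n) => (e : Set (Fin n))) '' E := by
    ext s
    constructor
    · exact fun hs => ⟨s.toFinset, by simpa [E] using hs, by simp⟩
    · rintro ⟨e, he, rfl⟩
      simpa [E] using he
  have hcard : H.edgeSet.ncard = #E := by
    rw [hE, Set.ncard_image_of_injective _ coe_injective, Set.ncard_coe_finset]
  rw [hcard] at hm ⊢
  obtain ⟨g, hg, hcoll⟩ := hlabel E hm
  rw [← Nat.le_div_iff_mul_le hC]
  exact H.isLeast_sumDistNumber.2 ⟨g, (isSumDistinguishing_iff_injOn hE g).2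
    ⟨fun v _ => (hg v).1, injOn_sum_of_collisions_eq_empty hcoll⟩,
    fun v _ => (Nat.le_div_iff_mul_le hC).2 (hg v).2⟩

lemma exists_mem_sumDistValues_lt {n k N m : ℕ} {U : Finset (Fin n)} (hk : 0 < k) (hm : 0 < m)
    (hmN : m ≤ k * N) (hU : 2 * m ^ 2 ≤ (#U).choose k)
    (hexp : 6 * m * (N : ℝ) ^ #U < Real.exp ((m : ℝ) ^ 2 / (4 * (k * N : ℕ)))) :
    ∃ s ∈ Hypergraph.sumDistValues n m, N < s := by
  obtain ⟨F, hF, hFf⟩ := exists_family_sum_not_injOn hk hm hmN hU hexp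
  obtain ⟨hFU, hFm⟩ := mem_powersetCard.1 hF
  let H : Hypergraph (Fin n) :=
    ⟨Set.univ, (fun e : Finset (Fin n) => (e : Set (Fin n))) '' F, fun _ _ => Set.subset_univ _⟩
  refine ⟨H.sumDistNumber, ⟨H, rfl, ?_, ?_, rfl⟩, not_le.1 fun hle => ?_⟩
  · rintro ⟨e, he, h_empty⟩
    obtain rfl : e = ∅ := coe_eq_empty.1 h_empty
    exact hk.ne (mem_powersetCard.1 (hFU he)).2
  · exact (Set.ncard_image_of_injective _ coe_injective).trans ((Set.ncard_coe_finset F).trans hFm)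
  · obtain ⟨f, hdist, hbound⟩ := H.isLeast_sumDistNumber.1
    obtain ⟨hpos, hinj⟩ := (isSumDistinguishing_iff_injOn rfl f).1 hdist
    exact hFf f (fun v => mem_Icc.2
      ⟨hpos v (Set.mem_univ v), (hbound v (Set.mem_univ v)).trans hle⟩) hinj

lemma ceil_rpow_half_le {n m : ℕ} {ε : ℝ} (hε : 0 < ε) (hmn : (m : ℝ) ≤ (n : ℝ) ^ (1 / ε)) :
    ⌈(m : ℝ) ^ (ε / 2)⌉₊ ≤ n := by
  obtain rfl | hn := n.eq_zero_or_pos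
  · rw [Nat.cast_zero, Real.zero_rpow (one_div_pos.2 hε).ne'] at hmn
    simp [le_antisymm hmn m.cast_nonneg, (half_pos hε).ne']
  rw [Nat.ceil_le]
  calc (m : ℝ) ^ (ε / 2) ≤ ((n : ℝ) ^ (1 / ε)) ^ (ε / 2) := by gcongr
    _ = (n : ℝ) ^ (1 / 2 : ℝ) := by
        rw [← Real.rpow_mul n.cast_nonneg]
        congr 1
        field_simp
    _ ≤ (n : ℝ) ^ (1 : ℝ) :=
        Real.rpow_le_rpow_of_exponent_le (by exact_mod_cast hn) (by norm_num)
    _ = n := Real.rpow_one _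

lemma exists_rpow_le_mem_sumDistValues {ε : ℝ} (hε : 0 < ε) (hε1 : ε ≤ 1) :
    ∃ m₀ : ℕ, ∀ n m : ℕ, m₀ ≤ m → (m : ℝ) ≤ (n : ℝ) ^ (1 / ε) →
      ∃ s ∈ Hypergraph.sumDistValues n m, (m : ℝ) ^ (2 - ε) ≤ s := by
  obtain ⟨k, hk⟩ := exists_nat_gt (4 / ε)
  have hk0 : 0 < k := Nat.cast_pos.1 (hk.trans' (by positivity))
  have hεk : 2 < ε / 2 * k := by
    rw [div_lt_iff₀ hε] at hk
    linarith
  obtain ⟨m₀, hm₀⟩ := Filter.eventually_atTop.1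
    ((eventually_two_mul_sq_le_choose_ceil_rpow (half_pos hε) hεk).and
      (eventually_mul_floor_pow_ceil_lt_exp hε (by linarith) hk0))
  refine ⟨max m₀ 1, fun n m hm hmn => ?_⟩
  obtain ⟨hchoose, hexp⟩ := hm₀ m (le_of_max_le_left hm)
  have hm1 : 1 ≤ m := le_of_max_le_right hm
  have hmN : m ≤ ⌊(m : ℝ) ^ (2 - ε)⌋₊ :=
    Nat.le_floor (Real.self_le_rpow_of_one_le (by exact_mod_cast hm1) (by linarith))
  obtain ⟨U, -, hU⟩ := exists_subset_card_eq
    ((ceil_rpow_half_le hε hmn).trans_eq (Finset.card_fin n).symm)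
  rw [← hU] at hchoose hexp
  obtain ⟨s, hs, hlt⟩ := exists_mem_sumDistValues_lt hk0 hm1
    (hmN.trans (Nat.le_mul_of_pos_left _ hk0)) hchoose hexp
  exact ⟨s, hs, (Nat.lt_of_floor_lt hlt).le⟩

lemma one_le_natCast_of_one_lt_rpow {n : ℕ} {a : ℝ} (h : 1 < (n : ℝ) ^ a) : (1 : ℝ) ≤ n := by
  refine Nat.one_le_cast.2 (Nat.one_le_iff_ne_zero.2 ?_)
  rintro rfl
  exact h.not_ge (by simpa using Real.zero_rpow_le_one a)

lemma exists_rpow_le_maxSumDistNumber_le {C ε : ℝ} (hC : 0 < C) (hε : 0 < ε) :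
    ∃ m₀ : ℕ, ∀ n m : ℕ, m₀ < m → (m : ℝ) ≤ (n : ℝ) ^ (1 / ε) →
      (m : ℝ) ^ (2 - ε) ≤ Hypergraph.maxSumDistNumber n m ∧
      Hypergraph.maxSumDistNumber n m ≤ (m : ℝ) ^ 2 / C := by
  have hC' : 0 < ⌈C⌉₊ := Nat.ceil_pos.2 hC
  have hδ : 0 < min ε 1 := lt_min hε one_pos
  obtain ⟨m₁, hupper⟩ := exists_sumDistValues_mul_le hC'
  obtain ⟨m₂, hlower⟩ := exists_rpow_le_mem_sumDistValues hδ (min_le_right ε 1)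
  refine ⟨max (max m₁ m₂) 1, fun n m hm hmn => ?_⟩
  obtain ⟨hm₁₂, hm_one⟩ := max_lt_iff.1 hm
  obtain ⟨hm₁, hm₂⟩ := max_lt_iff.1 hm₁₂
  have hm1 : (1 : ℝ) < m := Nat.one_lt_cast.2 hm_one
  have hn1 : (1 : ℝ) ≤ n := one_le_natCast_of_one_lt_rpow (hm1.trans_le hmn)
  have hup : ∀ s ∈ Hypergraph.sumDistValues n m, s ≤ m ^ 2 / ⌈C⌉₊ := fun s hs =>
    (Nat.le_div_iff_mul_le hC').2 (hupper n m hm₁.le s hs)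
  obtain ⟨s, hs, hms⟩ := hlower n m hm₂.le <| hmn.trans <|
    Real.rpow_le_rpow_of_exponent_le hn1 (one_div_le_one_div_of_le hδ (min_le_left ε 1))
  constructor
  · calc (m : ℝ) ^ (2 - ε) ≤ (m : ℝ) ^ (2 - min ε 1) :=
          Real.rpow_le_rpow_of_exponent_le hm1.le (sub_le_sub_left (min_le_left ε 1) 2)
      _ ≤ s := hms
      _ ≤ Hypergraph.maxSumDistNumber n m := by exact_mod_cast le_csSup ⟨_, hup⟩ hs
  · have hle : Hypergraph.maxSumDistNumber n m * ⌈C⌉₊ ≤ m ^ 2 :=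
      (Nat.le_div_iff_mul_le hC').1 (csSup_le ⟨s, hs⟩ hup)
    rw [le_div_iff₀ hC]
    calc (Hypergraph.maxSumDistNumber n m : ℝ) * C
        ≤ Hypergraph.maxSumDistNumber n m * ⌈C⌉₊ := by gcongr; exact Nat.le_ceil C
      _ ≤ (m : ℝ) ^ 2 := by exact_mod_cast hle

lemma sq_div_mem_Icc {x s C ε : ℝ} (hx : 0 < x) (hC : 0 < C) (hlow : x ^ (2 - ε) ≤ s)
    (hup : s ≤ x ^ 2 / C) : x ^ 2 / s ∈ Set.Icc C (x ^ ε) := by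
  have hs : 0 < s := hlow.trans_lt' (by positivity)
  constructor
  · rwa [le_div_comm₀ hC hs]
  · rw [div_le_iff₀ hs]
    calc x ^ 2 = x ^ ε * x ^ (2 - ε) := by rw [← Real.rpow_add hx]; norm_num
      _ ≤ x ^ ε * s := by gcongr

lemma exists_sq_div_maxSumDistNumber_mem_Icc (a C : ℝ) {δ : ℝ} (hδ : 0 < δ) :
    ∃ m₀ : ℕ, ∀ n m : ℕ, m₀ < m → (m : ℝ) ≤ (n : ℝ) ^ a →
      (m : ℝ) ^ 2 / Hypergraph.maxSumDistNumber n m ∈ Set.Icc C ((m : ℝ) ^ δ) := by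
  have hC : 0 < max C 1 := lt_max_of_lt_right one_pos
  have ha : 0 < max a 1 := lt_max_of_lt_right one_pos
  have hε : 0 < min δ (1 / max a 1) := lt_min hδ (one_div_pos.2 ha)
  set ε := min δ (1 / max a 1)
  have haε : max a 1 ≤ 1 / ε := (le_one_div ha hε).2 (min_le_right _ _)
  obtain ⟨m₀, hbounds⟩ := exists_rpow_le_maxSumDistNumber_le hC hε
  refine ⟨max m₀ 1, fun n m hm hmn => ?_⟩
  have hm1 : (1 : ℝ) < m := by exact_mod_cast (le_max_right m₀ 1).trans_lt hm
  have hn1 : (1 : ℝ) ≤ n := one_le_natCast_of_one_lt_rpow (hm1.trans_le hmn)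
  have hmε : (m : ℝ) ≤ (n : ℝ) ^ (1 / ε) :=
    hmn.trans (Real.rpow_le_rpow_of_exponent_le hn1 ((le_max_left a 1).trans haε))
  obtain ⟨hlow, hup⟩ := hbounds n m ((le_max_left m₀ 1).trans_lt hm) hmε
  refine Set.Icc_subset_Icc (le_max_left C 1) ?_ (sq_div_mem_Icc (one_pos.trans hm1) hC hlow hup)
  exact Real.rpow_le_rpow_of_exponent_le hm1.le (min_le_left δ _)

end SumDistNumber

theorem theorem1_general :
    (∀ C : ℝ, 0 < C → ∀ ε : ℝ, 0 < ε →
      ∃ m₀ : ℕ, ∀ n m : ℕ, m₀ < m → (m : ℝ) ≤ (n : ℝ) ^ (1 / ε) →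
        (m : ℝ) ^ (2 - ε) ≤ (Hypergraph.maxSumDistNumber n m : ℝ) ∧
        (Hypergraph.maxSumDistNumber n m : ℝ) ≤ (m : ℝ) ^ 2 / C) ∧
    (∃ w : ℕ → ℕ → ℝ, ∀ a : ℝ, ∀ C : ℝ, ∀ δ : ℝ, 0 < δ →
      ∃ m₀ : ℕ, ∀ n m : ℕ, m₀ < m → (m : ℝ) ≤ (n : ℝ) ^ a →
        (Hypergraph.maxSumDistNumber n m : ℝ) = (m : ℝ) ^ 2 / w n m ∧
        C ≤ w n m ∧ w n m ≤ (m : ℝ) ^ δ) := by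
  refine ⟨fun C hC ε hε => exists_rpow_le_maxSumDistNumber_le hC hε,
    fun n m => (m : ℝ) ^ 2 / Hypergraph.maxSumDistNumber n m, fun a C δ hδ => ?_⟩
  obtain ⟨m₀, hw⟩ := exists_sq_div_maxSumDistNumber_mem_Icc a C hδ
  refine ⟨m₀, fun n m hm hmn => ?_⟩
  obtain ⟨hC, hδ⟩ := hw n m hm hmn
  have hm0 : (m : ℝ) ^ 2 ≠ 0 := pow_ne_zero 2 (Nat.cast_ne_zero.2 (Nat.ne_zero_of_lt hm))
  exact ⟨(div_div_cancel₀ hm0).symm, hC, hδ⟩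

theorem theorem1 :
    (∀ C : ℝ, 0 < C → ∀ ε : ℝ, 0 < ε →
      ∃ n₀ : ℕ, ∀ n m : ℕ, n₀ < n → n ≤ m → (m : ℝ) ≤ (n : ℝ) ^ (1 / ε) →
        (m : ℝ) ^ (2 - ε) ≤ (Hypergraph.maxSumDistNumber n m : ℝ) ∧
        (Hypergraph.maxSumDistNumber n m : ℝ) ≤ (m : ℝ) ^ 2 / C) ∧
    (∃ w : ℕ → ℕ → ℝ, ∀ a : ℝ, ∀ C : ℝ, ∀ δ : ℝ, 0 < δ →
      ∃ n₀ : ℕ, ∀ n m : ℕ, n₀ < n → n ≤ m → (m : ℝ) ≤ (n : ℝ) ^ a →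
        (Hypergraph.maxSumDistNumber n m : ℝ) = (m : ℝ) ^ 2 / w n m ∧
        C ≤ w n m ∧ w n m ≤ (m : ℝ) ^ δ) := by
  obtain ⟨hbounds, w, hw⟩ := theorem1_general
  exact ⟨fun C hC ε hε => (hbounds C hC ε hε).imp fun _ h n m hn hnm => h n m (hn.trans_le hnm),
    w, fun a C δ hδ => (hw a C δ hδ).imp fun _ h n m hn hnm => h n m (hn.trans_le hnm)⟩
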